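/- Let $k$ be an algebraically closed field of characteristic $p>0$, and let $\bar x$ be a geometric point of the affine line $\mathbb A^1_k$, that is, a morphism $\operatorname{Spec}\Omega\to\mathbb A^1_k$ with $\Omega$ a separably closed field. Then the étale fundamental group $\pi_1^{\text{ét}}(\mathbb A^1_k,\bar x)$, i.e. the profinite group of automorphisms of the fibre functor $Y\mapsto \operatorname{Hom}_{\mathbb A^1_k}(\bar x,Y)$ on the category of finite étale coverings $Y\to\mathbb A^1_k$, is not topologically finitely generated: no finite subset of it generates a dense subgroup. -/

import Mathlib

open CategoryTheory AlgebraicGeometry Limits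

universe u

namespace EtalePi1

/-- The category of finite étale coverings of a scheme `X`: the full subcategory of the category of
`X`-schemes on those `Y` whose structure morphism `Y ⟶ X` is finite and étale. -/
abbrev FiniteEtaleCover (X : Scheme.{u}) : Type (u + 1) :=
  MorphismProperty.Over (@IsFinite ⊓ @Etale : MorphismProperty Scheme.{u}) ⊤ X

variable {X : Scheme.{u}} {Ω : Type u} [Field Ω]

/-- The `X`-morphisms from `Spec Ω` to a finite `X`-scheme `Y` form a finite set. -/
lemma finite_geometricFiber (x : Spec (.of Ω) ⟶ X) (Y : Over X) [IsFinite Y.hom] :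
    Finite (Over.mk x ⟶ Y) := by
  let q := pullback.snd Y.hom x
  let B : CommRingCat.{u} := Γ(pullback Y.hom x, ⊤)
  let j : CommRingCat.of Ω ⟶ B := (Scheme.ΓSpecIso (.of Ω)).inv ≫ q.appTop
  have hj : j.hom.Finite := by
    have h1 : (q.appTop).hom.Finite := Scheme.Hom.finite_appTop q
    have h2 : ((Scheme.ΓSpecIso (.of Ω)).inv.hom).Finite :=
      RingHom.Finite.of_surjective _
        (ConcreteCategory.bijective_of_isIso (Scheme.ΓSpecIso (.of Ω)).inv).2
    exact h1.comp h2
  let _ : Algebra Ω B := j.hom.toAlgebra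
  have : Module.Finite Ω B := hj
  have : IsAffine (pullback Y.hom x) := isAffine_of_isAffineHom q
  let σ (f : Over.mk x ⟶ Y) : Spec (.of Ω) ⟶ pullback Y.hom x :=
    pullback.lift f.left (𝟙 _) (by simp)
  have hσ₁ (f) : σ f ≫ pullback.fst Y.hom x = f.left := pullback.lift_fst _ _ _
  have hσ (f) : σ f ≫ q = 𝟙 _ := pullback.lift_snd _ _ _
  let Φ (f : Over.mk x ⟶ Y) : B →ₐ[Ω] Ω :=
    { toRingHom := ((σ f).appTop ≫ (Scheme.ΓSpecIso (.of Ω)).hom).hom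
      commutes' := fun r => by
        have h : j ≫ (σ f).appTop ≫ (Scheme.ΓSpecIso (.of Ω)).hom = 𝟙 _ := by
          have := congrArg Scheme.Hom.appTop (hσ f)
          rw [Scheme.Hom.comp_appTop] at this
          simp only [j, Category.assoc, reassoc_of% this]
          simp
        exact ConcreteCategory.congr_hom h r }
  refine Finite.of_injective Φ fun f g hfg => ?_
  have h1 : (σ f).appTop ≫ (Scheme.ΓSpecIso (.of Ω)).hom =
      (σ g).appTop ≫ (Scheme.ΓSpecIso (.of Ω)).hom := by
    ext b
    exact DFunLike.congr_fun hfg b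
  have h2 : σ f = σ g := ext_of_isAffine ((cancel_mono _).1 h1)
  ext1
  rw [← hσ₁ f, ← hσ₁ g, h2]

/-- The fibre functor of the finite étale coverings of `X` at a geometric point `x : Spec Ω ⟶ X`:
it sends `Y` to the finite set of geometric points of `Y` above `x`, that is, of morphisms
`Spec Ω ⟶ Y` over `X`, and a morphism of coverings to composition with it. -/
noncomputable def fiberFunctor (x : Spec (.of Ω) ⟶ X) : FiniteEtaleCover X ⥤ FintypeCat.{u} :=
  ObjectProperty.lift _
    (MorphismProperty.Over.forget _ ⊤ X ⋙ coyoneda.obj (Opposite.op (Over.mk x)))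
    fun Y =>
      haveI : IsFinite ((MorphismProperty.Over.forget _ ⊤ X).obj Y).hom := Y.prop.1
      finite_geometricFiber x ((MorphismProperty.Over.forget _ ⊤ X).obj Y)

/-- The étale fundamental group `π₁(X, x)`: the group of automorphisms of the fibre functor at `x`.
Its profinite topology is Mathlib's topology on `Aut F`, induced by the embedding into the product,
over all finite étale coverings `Y`, of the discrete permutation groups of the fibres. -/
abbrev EtaleFundamentalGroup (x : Spec (.of Ω) ⟶ X) : Type (u + 1) :=
  Aut (fiberFunctor x)

/-- A topological group is topologically finitely generated if some finite subset generates a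
dense subgroup. -/
def IsTopologicallyFG (G : Type*) [Group G] [TopologicalSpace G] [IsTopologicalGroup G] : Prop :=
  ∃ S : Finset G, (Subgroup.closure (S : Set G)).topologicalClosure = ⊤

end EtalePi1

/-!
The finite étale coverings of `𝔸¹ = Spec A`, `A = k[t]`, include the Artin–Schreier coverings
`y ^ p - y = f` for all `f : A`. The fibre of such a covering at a geometric point is a torsor under
`𝔽_p` on which `π₁` acts by translations, which gives a continuous character `π₁ → 𝔽_p`
(`artinSchreierCharacter`). If finitely many elements generated a dense subgroup, a continuous
character would be determined by its values on them, so only finitely many characters to `𝔽_p`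
could exist (`not_isTopologicallyFG_of_monoidHom`). But the characters belonging to the polynomials
`f = t ^ (p * n + 1)` are pairwise distinct.

To separate them one needs enough elements of `π₁`, and these come from the absolute Galois group
of `K = k(t)`. Let `L` be a separable closure of `K` and `B` the integral closure of `A` in `L`. As
`k` is algebraically closed, the geometric point `A → Ω` extends to `ε : B → Ω`
(`exists_algHom_integralClosure`). For a finite étale `A`-algebra `R`, composition with `ε` is a
bijection `Hom_A(R, B) → Hom_A(R, Ω)` (`bijective_comp_of_integralClosure`): it is injective because
`B` is a domain and `R` is unramified, and both sides have `rank_A R` elements. So an automorphism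
`τ` of `B` over `A` acts on the fibre functor (`autOfBijective`). On the covering `y ^ p - y = f`,
with root `a : B`, its character takes the value `ε (τ a - a)`. For two polynomials `f`, `g` with
roots `a`, `b`, some `τ` from the Galois group moves `a - b` unless `f - g = y ^ p - y` with
`y : A` (`exists_algEquiv_sub_ne`), and comparing degrees excludes the latter for
`f - g = t ^ (p * i + 1) - t ^ (p * j + 1)` (`pow_sub_self_ne_X_pow_sub_X_pow`).
-/

namespace EtalePi1

open Polynomial TensorProduct
open scoped PreGaloisCategory

/-! ### Lifting geometric points of finite étale algebras to an integral closure -/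

/-- A free finite étale algebra has as many points in a separably closed field as its
rank: after base change to that field it splits completely. -/
lemma finite_algHom_and_card_eq_finrank (A R E : Type u) [CommRing A] [CommRing R] [Algebra A R]
    [Module.Finite A R] [Module.Free A R] [Algebra.Etale A R] [Field E] [IsSepClosed E]
    [Algebra A E] : Finite (R →ₐ[A] E) ∧ Nat.card (R →ₐ[A] E) = Module.finrank A R := by
  have : Nontrivial A := (algebraMap A E).domain_nontrivial
  have : IsArtinianRing (E ⊗[A] R) := isArtinian_of_tower E inferInstance
  let e₁ := (Algebra.TensorProduct.liftEquivRight A E R E).trans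
    (Algebra.IsFiniteSplit.algHomEquivPrimeSpectrum E (E ⊗[A] R))
  let e₂ := Algebra.FormallyEtale.equivPiOfIsSepClosed E (E ⊗[A] R)
  have := Fintype.ofFinite (PrimeSpectrum (E ⊗[A] R))
  refine ⟨.of_equiv _ e₁.symm, ?_⟩
  rw [Nat.card_congr e₁, Nat.card_eq_fintype_card, ← Module.finrank_fintype_fun_eq_card E,
    ← e₂.toLinearEquiv.finrank_eq, Module.finrank_baseChange]

/-- Two maps from an unramified algebra to a domain (whose spectrum is connected) are equal as soon
as they agree at one point. -/
lemma algHom_eq_of_comp_eq_of_formallyUnramified {A R B C : Type*} [CommRing A] [CommRing R]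
    [CommRing B] [CommRing C] [Algebra A R] [Algebra A B] [Algebra A C] [IsDomain B] [Nontrivial C]
    [Algebra.FormallyUnramified A R] [Algebra.EssFiniteType A R] (ε : B →ₐ[A] C) {f g : R →ₐ[A] B}
    (h : ε.comp f = ε.comp g) : f = g := by
  -- `e` cuts out the diagonal of `Spec R ×[A] Spec R` as an open and closed subscheme. Its image in
  -- the domain `B` is nonzero because its image in `C` is `1`.
  let e := Algebra.FormallyUnramified.elem A R
  let T : R ⊗[A] R →ₐ[A] B := Algebra.TensorProduct.lift f g fun _ _ ↦ .all _ _
  have hT : ε.comp T = (ε.comp f).comp (Algebra.TensorProduct.lmul' A) := by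
    ext x
    · simp [T]
    · simpa [T] using DFunLike.congr_fun h.symm x
  have he : T e ≠ 0 := fun h0 ↦ by
    have := DFunLike.congr_fun hT e
    simp [h0, e, Algebra.FormallyUnramified.lmul_elem] at this
  ext s
  have := congrArg T (Algebra.FormallyUnramified.one_tmul_mul_elem (R := A) s)
  rw [map_mul, map_mul] at this
  simpa [T] using (mul_right_cancel₀ he this).symm

/-- The fibre of a finite étale algebra at the geometric point `Ω` is identified with its fibre at
the generic geometric point `L`, by specialization along `ε`. -/
lemma bijective_comp_of_integralClosure {A L Ω : Type u} (R : Type u) [CommRing A] [IsDomain A]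
    [IsPrincipalIdealRing A] [CommRing R] [Algebra A R] [Module.Finite A R] [Algebra.Etale A R]
    [Field L] [IsSepClosed L] [Algebra A L] [Field Ω] [IsSepClosed Ω] [Algebra A Ω]
    (ε : integralClosure A L →ₐ[A] Ω) :
    Function.Bijective fun f : R →ₐ[A] integralClosure A L ↦ ε.comp f := by
  have : Module.Projective A R := inferInstance
  let e : (R →ₐ[A] integralClosure A L) ≃ (R →ₐ[A] L) :=
    -- The elements of `R` are integral over `A`, so maps `R → L` land in the integral closure.
    { toFun f := (integralClosure A L).val.comp f
      invFun g := g.codRestrict _ fun r ↦ (Algebra.IsIntegral.isIntegral (R := A) r).map g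
      left_inv f := by ext; rfl
      right_inv g := by ext; rfl }
  obtain ⟨_, hΩ⟩ := finite_algHom_and_card_eq_finrank A R Ω
  obtain ⟨_, hL⟩ := finite_algHom_and_card_eq_finrank A R L
  exact (Nat.bijective_iff_injective_and_card _).2
    ⟨fun f g h ↦ algHom_eq_of_comp_eq_of_formallyUnramified ε h, by
      rw [Nat.card_congr e, hL, hΩ]⟩

/-- A geometric point of `Spec k[X]` lifts to the integral closure in a separable extension `L` of
`k(X)`. Over the generic point it extends to all of `L`; over a closed point the residue fields of
the integral closure are algebraic over `k`, hence equal to `k`. -/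
lemma exists_algHom_integralClosure (k K L Ω : Type*) [Field k] [IsAlgClosed k] [Field K]
    [Algebra k[X] K] [IsFractionRing k[X] K] [Field L] [Algebra K L] [Algebra.IsSeparable K L]
    [Algebra k[X] L] [IsScalarTower k[X] K L] [Field Ω] [IsSepClosed Ω] [Algebra k[X] Ω] :
    Nonempty (integralClosure k[X] L →ₐ[k[X]] Ω) := by
  let φ : k[X] →+* Ω := algebraMap k[X] Ω
  by_cases hφ : RingHom.ker φ = ⊥
  · have hinj : Function.Injective φ := (RingHom.injective_iff_ker_eq_bot φ).2 hφ
    let _ : Algebra K Ω := (IsFractionRing.lift hinj).toAlgebra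
    have : IsScalarTower k[X] K Ω := .of_algebraMap_eq fun f ↦
      (IsFractionRing.lift_algebraMap hinj f).symm
    let i : L →ₐ[K] Ω := IsSepClosed.lift
    exact ⟨(i.restrictScalars k[X]).comp (integralClosure k[X] L).val⟩
  · let m := RingHom.ker φ
    have : m.IsPrime := RingHom.ker_isPrime φ
    have : m.IsMaximal := IsPrime.to_maximal_ideal hφ
    let B := integralClosure k[X] L
    have : FaithfulSMul k[X] L := .trans k[X] K L
    have : FaithfulSMul k[X] B := inferInstance
    obtain ⟨P, hP, hPm⟩ := Ideal.exists_maximal_ideal_liesOver_of_isIntegral (S := B) m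
    let _ : Field (k[X] ⧸ m) := Ideal.Quotient.field m
    have h₁ : Module.Finite k (k[X] ⧸ m) := finite_of_finite_type_of_isJacobsonRing _ _
    let ψ : k →+* B ⧸ P :=
      (algebraMap (k[X] ⧸ m) (B ⧸ P)).comp (algebraMap k (k[X] ⧸ m))
    have hψ : ψ.IsIntegral := RingHom.IsIntegral.trans _ _
      (algebraMap_isIntegral_iff.2 inferInstance) (algebraMap_isIntegral_iff.2 inferInstance)
    let e := RingEquiv.ofBijective ψ (IsAlgClosed.ringHom_bijective_of_isIntegral ψ hψ)
    refine ⟨⟨((φ.comp C).comp e.symm.toRingHom).comp (Ideal.Quotient.mk P), fun f ↦ ?_⟩⟩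
    obtain ⟨c, hc⟩ := e.surjective (Ideal.Quotient.mk P (algebraMap k[X] B f))
    have hfc : f - C c ∈ m := by
      rw [Ideal.mem_of_liesOver P m, map_sub, ← Ideal.Quotient.eq, ← hc]
      rfl
    change φ (C (e.symm (Ideal.Quotient.mk P (algebraMap k[X] B f)))) = φ f
    rw [← hc, e.symm_apply_apply]
    exact (sub_eq_zero.1 ((map_sub φ _ _).symm.trans hfc)).symm

/-! ### Artin–Schreier equations -/

section ArtinSchreier

variable (p : ℕ) [Fact p.Prime]

/-- The presentation of `A[y] / (y ^ p - y - h)`, over a ring `A` of characteristic `p`, as a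
standard étale algebra; nothing is inverted, as the derivative of `y ^ p - y - h` is `-1`. -/
noncomputable def artinSchreierPair {A : Type*} [CommRing A] [CharP A p] (h : A) :
    StandardEtalePair A where
  f := X ^ p - (X + C h)
  monic_f := by
    nontriviality A
    refine monic_X_pow_sub ?_
    rw [degree_X_add_C]
    exact_mod_cast (Fact.out : p.Prime).one_lt
  g := 1
  cond := ⟨-1, 0, 0, by simp [derivative_X_pow]⟩

variable {p}
variable {A : Type*} [CommRing A] [CharP A p]

lemma artinSchreierPair_hasMap_iff {h : A} {S : Type*} [CommRing S] [Algebra A S] {x : S} :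
    (artinSchreierPair p h).HasMap x ↔ x ^ p - x = algebraMap A S h := by
  simp only [StandardEtalePair.HasMap, artinSchreierPair, map_sub, map_pow, map_add, aeval_X,
    aeval_C, map_one, isUnit_one, and_true]
  grind

instance finite_artinSchreierPair_ring (h : A) : Module.Finite A (artinSchreierPair p h).Ring := by
  have := (artinSchreierPair p h).monic_f.finite_adjoinRoot
  let φ : AdjoinRoot (artinSchreierPair p h).f →ₐ[A] (artinSchreierPair p h).Ring :=
    AdjoinRoot.liftAlgHom _ (Algebra.ofId _ _) (artinSchreierPair p h).X
      (artinSchreierPair p h).hasMap_X.1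
  let ψ := (artinSchreierPair p h).lift (AdjoinRoot.root (artinSchreierPair p h).f)
    ⟨by simp, by rw [artinSchreierPair, map_one]; exact isUnit_one⟩
  have hφψ : φ.comp ψ = .id _ _ := StandardEtalePair.hom_ext <| by
    have hψ : ψ (artinSchreierPair p h).X = AdjoinRoot.root _ := StandardEtalePair.lift_X ..
    rw [AlgHom.comp_apply, hψ]
    exact AdjoinRoot.liftAlgHom_root ..
  exact Module.Finite.of_surjective φ.toLinearMap fun x ↦ ⟨ψ x, DFunLike.congr_fun hφψ x⟩

lemma exists_pow_sub_self_eq {L : Type*} [Field L] [IsSepClosed L] [CharP L p] (h : L) :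
    ∃ a : L, a ^ p - a = h := by
  let P := artinSchreierPair p h
  have hdeg : P.f.degree ≠ 0 := by
    have : P.f.degree = p := by
      refine (degree_sub_eq_left_of_degree_lt ?_).trans (degree_X_pow p)
      rw [degree_X_add_C, degree_X_pow]
      exact_mod_cast (Fact.out : p.Prime).one_lt
    rw [this]
    exact_mod_cast (Fact.out : p.Prime).ne_zero
  obtain ⟨p₁, p₂, n, e⟩ := P.cond
  have hsep : P.f.Separable := ⟨p₂, p₁, by
    rw [mul_comm p₂, mul_comm p₁, add_comm, e]
    simp [P, artinSchreierPair]⟩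
  obtain ⟨a, ha⟩ := IsSepClosed.exists_aeval_eq_zero L P.f hdeg hsep
  exact ⟨a, artinSchreierPair_hasMap_iff.1 ⟨ha, by simp [artinSchreierPair]⟩⟩

lemma exists_pow_sub_self_eq_algebraMap {L : Type*} [Field L] [IsSepClosed L] [Algebra A L]
    [CharP L p] (h : A) : ∃ a : integralClosure A L, a ^ p - a = algebraMap A _ h := by
  obtain ⟨a, ha⟩ := exists_pow_sub_self_eq (p := p) (algebraMap A L h)
  refine ⟨⟨a, (artinSchreierPair p h).f, (artinSchreierPair p h).monic_f, ?_⟩, Subtype.ext ha⟩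
  exact (artinSchreierPair_hasMap_iff.2 ha).1

/-- If `f - g` is not of the form `y ^ p - y` in `A`, roots of the Artin–Schreier equations of `f`
and `g` are moved by different amounts under some automorphism: otherwise the difference of the roots
would be fixed by the Galois group, hence lie in `K`, and then in `A` since it is integral. -/
lemma exists_algEquiv_sub_ne {A K L : Type*} [CommRing A] [IsDomain A] [IsIntegrallyClosed A]
    [Field K] [Algebra A K] [IsFractionRing A K] [Field L] [CharP L p] [Algebra K L] [IsGalois K L]
    [Algebra A L] [IsScalarTower A K L] {f g : A} (hfg : ∀ y : A, y ^ p - y ≠ f - g)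
    {a b : integralClosure A L}
    (ha : a ^ p - a = algebraMap A _ f) (hb : b ^ p - b = algebraMap A _ g) :
    ∃ τ : integralClosure A L ≃ₐ[A] integralClosure A L, τ a - a ≠ τ b - b := by
  by_contra! H
  have hfix : ∀ σ : Gal(L/K), σ ((a : L) - b) = a - b := fun σ ↦ by
    have := congrArg Subtype.val (H (σ.restrictScalars A).mapIntegralClosure)
    simp only [AddSubgroupClass.coe_sub] at this
    change σ a - a = σ b - b at this
    rw [map_sub]
    linear_combination this
  obtain ⟨z, hz⟩ := (InfiniteGalois.mem_range_algebraMap_iff_fixed _).2 hfix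
  have hzA : z ^ p - z = algebraMap A K (f - g) := by
    apply (algebraMap K L).injective
    have ha' : (a : L) ^ p - a = algebraMap A L f := congrArg Subtype.val ha
    have hb' : (b : L) ^ p - b = algebraMap A L g := congrArg Subtype.val hb
    rw [map_sub, map_pow, hz, sub_pow_char, ← IsScalarTower.algebraMap_apply, map_sub]
    linear_combination ha' - hb'
  have hint : IsIntegral A z := by
    refine (isIntegral_algHom_iff (IsScalarTower.toAlgHom A K L) (algebraMap K L).injective).1 ?_
    change IsIntegral A (algebraMap K L z)
    rw [hz]
    exact a.2.sub b.2
  obtain ⟨y, rfl⟩ := IsIntegrallyClosed.isIntegral_iff.1 hint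
  exact hfg y (IsFractionRing.injective A K (by simpa using hzA))

/-- The degree of `y ^ p - y` is divisible by `p`. -/
lemma pow_sub_self_ne_X_pow_sub_X_pow {k : Type*} [Field k] [CharP k p] {i j : ℕ}
    (hij : i ≠ j) (y : k[X]) : y ^ p - y ≠ X ^ (p * i + 1) - X ^ (p * j + 1) := by
  wlog h : j < i generalizing i j y
  · intro hy
    refine this hij.symm (-y) (by omega) ?_
    have hneg : (-y) ^ p = -y ^ p := by
      simpa [(Fact.out : p.Prime).ne_zero] using sub_pow_char (0 : k[X]) y
    rw [hneg]
    linear_combination -hy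
  intro hy
  have hp := (Fact.out : p.Prime).one_lt
  have hR : (X ^ (p * i + 1) - X ^ (p * j + 1) : k[X]).natDegree = p * i + 1 := by
    rw [natDegree_sub_eq_left_of_natDegree_lt] <;> simp only [natDegree_X_pow]
    gcongr
  have hL : (y ^ p - y).natDegree = p * y.natDegree := by
    rcases Nat.eq_zero_or_pos y.natDegree with h0 | h0
    · obtain ⟨c, rfl⟩ := natDegree_eq_zero.1 h0
      rw [← C_pow, ← C_sub, natDegree_C, natDegree_C, mul_zero]
    · rw [natDegree_sub_eq_left_of_natDegree_lt, natDegree_pow]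
      rw [natDegree_pow]
      nlinarith
  rw [← hy, hL] at hR
  have : p ∣ 1 := (Nat.dvd_add_right (dvd_mul_right p i)).1 (hR ▸ dvd_mul_right p _)
  exact hp.ne' (Nat.dvd_one.1 this)

end ArtinSchreier

/-! ### Automorphisms of the fibre functor -/

section Action

variable {X : Scheme.{u}} {Ω : Type u} [Field Ω] {x : Spec (.of Ω) ⟶ X}

/-- The `X`-scheme underlying a finite étale covering. -/
abbrev FiniteEtaleCover.toOver (Y : FiniteEtaleCover X) : Over X :=
  (MorphismProperty.Over.forget _ ⊤ X).obj Y

/-- If every point of a covering over `x` factors uniquely through `e : x ⟶ T`, an automorphism `τ`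
of `T` over `X` acts on the fibre functor at `x`. It sends `e ≫ g` to `e ≫ τ.inv ≫ g`. -/
noncomputable def autOfBijective {T : Over X} (e : Over.mk x ⟶ T)
    (he : ∀ Y : FiniteEtaleCover X, Function.Bijective fun g : T ⟶ Y.toOver ↦ e ≫ g)
    (τ : T ≅ T) : EtaleFundamentalGroup x :=
  NatIso.ofComponents
    (fun Y ↦ FintypeCat.equivEquivIso
      (((Equiv.ofBijective _ (he Y)).symm.trans τ.homFromEquiv).trans (Equiv.ofBijective _ (he Y)) :
        (Over.mk x ⟶ Y.toOver) ≃ (Over.mk x ⟶ Y.toOver)))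
    fun {Y Z} f ↦ by
      ext q
      obtain ⟨g, rfl⟩ := (he Y).2 q
      have hY (g' : T ⟶ Y.toOver) : (Equiv.ofBijective _ (he Y)).symm (e ≫ g') = g' :=
        (Equiv.ofBijective _ (he Y)).symm_apply_apply g'
      have hZ (g' : T ⟶ Z.toOver) : (Equiv.ofBijective _ (he Z)).symm (e ≫ g') = g' :=
        (Equiv.ofBijective _ (he Z)).symm_apply_apply g'
      let f' : Y.toOver ⟶ Z.toOver := (MorphismProperty.Over.forget _ ⊤ X).map f
      change e ≫ τ.inv ≫ (Equiv.ofBijective _ (he Z)).symm ((e ≫ g) ≫ f') =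
        (e ≫ τ.inv ≫ (Equiv.ofBijective _ (he Y)).symm (e ≫ g)) ≫ f'
      rw [hY, Category.assoc, hZ, Category.assoc, Category.assoc]

lemma autOfBijective_smul {T : Over X} (e : Over.mk x ⟶ T)
    (he : ∀ Y : FiniteEtaleCover X, Function.Bijective fun g : T ⟶ Y.toOver ↦ e ≫ g)
    (τ : T ≅ T) (Y : FiniteEtaleCover X) (g : T ⟶ Y.toOver) :
    autOfBijective e he τ • (show (fiberFunctor x).obj Y from e ≫ g) = (e ≫ τ.inv ≫ g :) :=
  congrArg (fun g' ↦ e ≫ τ.inv ≫ g') ((Equiv.ofBijective _ (he Y)).symm_apply_apply g)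

end Action

/-! ### Finite étale coverings of an affine scheme -/

section Affine

variable {X : Scheme.{u}} {A : Type u} [CommRing A] (i : Spec (.of A) ≅ X)

/-- The scheme `Spec R` over `X`, where `X` is identified with `Spec A` by `i`. -/
noncomputable abbrev specOver (R : Type u) [CommRing R] [Algebra A R] : Over X :=
  Over.mk (Spec.map (CommRingCat.ofHom (algebraMap A R)) ≫ i.hom)

variable {R S T : Type u} [CommRing R] [Algebra A R] [CommRing S] [Algebra A S]
  [CommRing T] [Algebra A T]

/-- The morphism `Spec S ⟶ Spec R` over `X` of a homomorphism of `A`-algebras `R → S`. -/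
noncomputable def specOverMap (f : R →ₐ[A] S) : specOver i S ⟶ specOver i R :=
  Over.homMk (Spec.map (CommRingCat.ofHom f.toRingHom)) <| by
    dsimp
    rw [← Spec.map_comp_assoc, ← CommRingCat.ofHom_comp]
    congr 3
    exact f.comp_algebraMap

lemma specOverMap_comp (f : R →ₐ[A] S) (g : S →ₐ[A] T) :
    specOverMap i (g.comp f) = specOverMap i g ≫ specOverMap i f := by
  apply Over.OverMorphism.ext
  exact Spec.map_comp (CommRingCat.ofHom f.toRingHom) (CommRingCat.ofHom g.toRingHom)

variable (S) in
lemma specOverMap_id : specOverMap i (.id A S) = 𝟙 (specOver i S) := by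
  apply Over.OverMorphism.ext
  exact Spec.map_id _

/-- The isomorphism `Spec S ≅ Spec R` over `X` of an isomorphism of `A`-algebras `R ≃ S`. -/
noncomputable def specOverIso (e : R ≃ₐ[A] S) : specOver i S ≅ specOver i R where
  hom := specOverMap i e.toAlgHom
  inv := specOverMap i e.symm.toAlgHom
  hom_inv_id := by rw [← specOverMap_comp, ← specOverMap_id]; congr; ext; simp
  inv_hom_id := by rw [← specOverMap_comp, ← specOverMap_id]; congr; ext; simp

lemma specOverMap_bijective :
    Function.Bijective (specOverMap i : (R →ₐ[A] S) → (specOver i S ⟶ specOver i R)) := by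
  constructor
  · intro f g h
    have := Spec.map_injective (congrArg CommaMorphism.left h)
    ext r
    exact ConcreteCategory.congr_hom this r
  · intro g
    have hw := Over.w g
    dsimp at hw
    rw [← Category.assoc, cancel_mono] at hw
    obtain ⟨φ, hφ⟩ := Spec.map_surjective g.left
    rw [← hφ, ← Spec.map_comp] at hw
    refine ⟨⟨φ.hom, fun a ↦ ConcreteCategory.congr_hom (Spec.map_injective hw) a⟩, ?_⟩
    ext1
    exact hφ

lemma exists_iso_specOver (Y : FiniteEtaleCover X) : ∃ (R : Type u) (_ : CommRing R)
    (_ : Algebra A R) (_ : Module.Finite A R) (_ : Algebra.Etale A R),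
    Nonempty (Y.toOver ≅ specOver i R) := by
  have : IsFinite Y.toOver.hom := Y.prop.1
  have : Etale Y.toOver.hom := Y.prop.2
  have : IsAffine X := .of_isIso i.inv
  have : IsAffine Y.toOver.left := isAffine_of_isAffineHom Y.toOver.hom
  let φ : CommRingCat.of A ⟶ Γ(Y.toOver.left, ⊤) :=
    Spec.preimage (Y.toOver.left.isoSpec.inv ≫ Y.toOver.hom ≫ i.inv)
  have hφ : Spec.map φ = Y.toOver.left.isoSpec.inv ≫ Y.toOver.hom ≫ i.inv := Spec.map_preimage _
  have hfin : φ.hom.Finite := by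
    rw [← IsFinite.SpecMap_iff, hφ]
    infer_instance
  have het : φ.hom.Etale := by
    rw [← HasRingHomProperty.Spec_iff (P := @Etale), hφ]
    infer_instance
  let _ : Algebra A Γ(Y.toOver.left, ⊤) := φ.hom.toAlgebra
  refine ⟨Γ(Y.toOver.left, ⊤), inferInstance, φ.hom.toAlgebra, hfin, het,
    ⟨Over.isoMk Y.toOver.left.isoSpec ?_⟩⟩
  change Y.toOver.left.isoSpec.hom ≫ Spec.map φ ≫ i.hom = _
  simp [hφ]

/-- The bijectivity assumption of `autOfBijective` may be checked on finite étale algebras. -/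
lemma bijective_specOverMap_comp {Ω : Type u} [Field Ω] [Algebra A Ω] (ε : S →ₐ[A] Ω)
    (hε : ∀ (R : Type u) [CommRing R] [Algebra A R] [Module.Finite A R] [Algebra.Etale A R],
      Function.Bijective fun f : R →ₐ[A] S ↦ ε.comp f) (Y : FiniteEtaleCover X) :
    Function.Bijective fun g : specOver i S ⟶ Y.toOver ↦ specOverMap i ε ≫ g := by
  obtain ⟨R, _, _, _, _, ⟨j⟩⟩ := exists_iso_specOver i Y
  have h₁ : Function.Bijective fun f : R →ₐ[A] S ↦ specOverMap i (ε.comp f) ≫ j.inv :=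
    (j.symm.homToEquiv.bijective.comp (specOverMap_bijective i)).comp (hε R)
  have h₂ := j.symm.homToEquiv.bijective.comp (specOverMap_bijective (R := R) (S := S) i)
  refine (Function.Bijective.of_comp_iff _ h₂).1 ?_
  convert h₁ using 2 with f
  simp [specOverMap_comp]

variable (R) in
/-- The finite étale covering `Spec R ⟶ X` of a finite étale `A`-algebra `R`. -/
noncomputable def specCover [Module.Finite A R] [Algebra.Etale A R] : FiniteEtaleCover X :=
  MorphismProperty.Over.mk ⊤ (specOver i R).hom <| by
    constructor
    · have : IsFinite (Spec.map (CommRingCat.ofHom (algebraMap A R))) :=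
        (IsFinite.SpecMap_iff _).2 (RingHom.finite_algebraMap.2 inferInstance)
      exact inferInstanceAs (IsFinite (_ ≫ i.hom))
    · have : Etale (Spec.map (CommRingCat.ofHom (algebraMap A R))) :=
        (HasRingHomProperty.Spec_iff (P := @Etale)).2 (RingHom.etale_algebraMap.2 inferInstance)
      exact inferInstanceAs (Etale (_ ≫ i.hom))

/-- The morphism of coverings `Spec S ⟶ Spec R` of a homomorphism of `A`-algebras `R → S`. -/
noncomputable def specCoverMap [Module.Finite A R] [Algebra.Etale A R] [Module.Finite A S]
    [Algebra.Etale A S] (f : R →ₐ[A] S) : specCover i S ⟶ specCover i R :=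
  MorphismProperty.Over.homMk (specOverMap i f).left (Over.w (specOverMap i f))

variable (Ω : Type u) [Field Ω] [Algebra A Ω]
variable (R) in
/-- The fibre of `Spec R` at the geometric point `Ω` is the set of `A`-algebra maps `R → Ω`. -/
noncomputable def fiberEquiv [Module.Finite A R] [Algebra.Etale A R] :
    (R →ₐ[A] Ω) ≃ (fiberFunctor (specOver i Ω).hom).obj (specCover i R) :=
  .ofBijective (specOverMap i) (specOverMap_bijective i)

lemma fiberEquiv_comp [Module.Finite A R] [Algebra.Etale A R] [Module.Finite A S]
    [Algebra.Etale A S] (f : R →ₐ[A] S) (q : S →ₐ[A] Ω) :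
    fiberEquiv i R Ω (q.comp f) =
      (fiberFunctor (specOver i Ω).hom).map (specCoverMap i f) (fiberEquiv i S Ω q) :=
  specOverMap_comp i f q

end Affine

/-! ### Artin–Schreier characters of the fundamental group -/

/-- A topologically finitely generated group has only finitely many continuous homomorphisms with
values in a given finite set. Continuity enters only through the closedness of the loci where two of
them agree, so that `M` needs no topology. -/
lemma not_isTopologicallyFG_of_monoidHom {G M ι : Type*} [Group G] [TopologicalSpace G]
    [IsTopologicalGroup G] [Group M] [Infinite ι] {V : Set M} (hV : V.Finite) (c : ι → G →* M)
    (hcV : ∀ i σ, c i σ ∈ V) (hc : Function.Injective c)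
    (hclosed : ∀ i j, IsClosed {σ | c i σ = c j σ}) : ¬ IsTopologicallyFG G := by
  rintro ⟨S, hS⟩
  have := hV.to_subtype
  obtain ⟨i, j, hij, h⟩ := Finite.exists_ne_map_eq_of_infinite
    fun (i : ι) (s : S) ↦ (⟨c i s, hcV i s⟩ : V)
  refine hij (hc ?_)
  have hle : Subgroup.closure (S : Set G) ≤ (c i).eqLocus (c j) :=
    (Subgroup.closure_le _).2 fun s hs ↦ congrArg Subtype.val (congrFun h ⟨s, hs⟩)
  have htop : (⊤ : Subgroup G) ≤ (c i).eqLocus (c j) :=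
    hS ▸ Subgroup.topologicalClosure_minimal _ hle (hclosed i j)
  ext σ
  exact htop (Subgroup.mem_top σ)

lemma exists_natCast_eq_of_pow_eq {F : Type*} [Field F] {p : ℕ} [Fact p.Prime] [CharP F p] {c : F}
    (hc : c ^ p = c) : ∃ n : ℕ, (n : F) = c := by
  rw [← Subfield.mem_bot_iff_pow_eq_self F p, ← ZMod.fieldRange_castHom_eq_bot p] at hc
  obtain ⟨n, rfl⟩ := hc
  exact ⟨n.val, by simp⟩

section Character

variable {X : Scheme.{u}} {A : Type u} [CommRing A] (i : Spec (.of A) ≅ X)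
variable (p : ℕ) [Fact p.Prime] [CharP A p] {Ω : Type u} [Field Ω] [Algebra A Ω]

/-- The covering `y ^ p - y = f` of `X`. -/
noncomputable abbrev artinSchreierCover (f : A) : FiniteEtaleCover X :=
  specCover i (artinSchreierPair p f).Ring

variable (Ω) in
/-- The fibre of the covering `y ^ p - y = f` at the geometric point `Ω`. -/
noncomputable abbrev artinSchreierFiber (f : A) : Type u :=
  (fiberFunctor (specOver i Ω).hom).obj (artinSchreierCover i p f)

variable {p i} {f : A}

/-- The value of the coordinate `y` at a point of the fibre of `y ^ p - y = f`. It embeds the fibre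
into `Ω` as the set of roots of this equation. -/
noncomputable def fiberCoord (y : artinSchreierFiber i p Ω f) : Ω :=
  (fiberEquiv i (artinSchreierPair p f).Ring Ω).symm y (artinSchreierPair p f).X

lemma fiberCoord_fiberEquiv (q : (artinSchreierPair p f).Ring →ₐ[A] Ω) :
    fiberCoord (fiberEquiv i _ Ω q) = q (artinSchreierPair p f).X := by
  simp [fiberCoord]

lemma fiberCoord_injective :
    Function.Injective (fiberCoord : artinSchreierFiber i p Ω f → Ω) := fun _ _ h ↦
  (fiberEquiv i _ Ω).symm.injective (StandardEtalePair.hom_ext h)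

lemma fiberCoord_pow_sub (y : artinSchreierFiber i p Ω f) :
    fiberCoord y ^ p - fiberCoord y = algebraMap A Ω f :=
  artinSchreierPair_hasMap_iff.1
    (StandardEtalePair.hasMap_X.map ((fiberEquiv i (artinSchreierPair p f).Ring Ω).symm y))

variable (p f) in
/-- The automorphism `y ↦ y + n` of the algebra `A[y] / (y ^ p - y - f)`, as an endomorphism. -/
noncomputable def artinSchreierTranslation (n : ℕ) :
    (artinSchreierPair p f).Ring →ₐ[A] (artinSchreierPair p f).Ring :=
  (artinSchreierPair p f).lift ((artinSchreierPair p f).X + n) <| by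
    have hX := artinSchreierPair_hasMap_iff.1 (artinSchreierPair p f).hasMap_X
    rw [artinSchreierPair_hasMap_iff, ← hX]
    nontriviality (artinSchreierPair p f).Ring
    have : CharP (artinSchreierPair p f).Ring p :=
      (CharP.charP_iff_prime_eq_zero Fact.out).2 <| by
        rw [← map_natCast (algebraMap A _), CharP.cast_eq_zero, map_zero]
    have hn : (n : (artinSchreierPair p f).Ring) ^ p = n := map_natCast (frobenius _ p) n
    rw [add_pow_char, hn]
    ring

lemma fiberCoord_map_translation (n : ℕ) (y : artinSchreierFiber i p Ω f) :
    fiberCoord ((fiberFunctor (specOver i Ω).hom).map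
      (specCoverMap i (artinSchreierTranslation p f n)) y) = fiberCoord y + n := by
  obtain ⟨q, rfl⟩ := (fiberEquiv i _ Ω).surjective y
  rw [← fiberEquiv_comp, fiberCoord_fiberEquiv, fiberCoord_fiberEquiv, AlgHom.comp_apply,
    artinSchreierTranslation, StandardEtalePair.lift_X, map_add, map_natCast]

variable [CharP Ω p]

lemma fiberCoord_sub_pow (y z : artinSchreierFiber i p Ω f) :
    (fiberCoord z - fiberCoord y) ^ p = fiberCoord z - fiberCoord y := by
  rw [sub_pow_char]
  linear_combination fiberCoord_pow_sub z - fiberCoord_pow_sub y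

/-- An element of the fundamental group translates all points of the fibre by the same amount,
because its action commutes with the automorphisms `y ↦ y + n`, which permute the fibre transitively. -/
lemma fiberCoord_smul_sub (σ : EtaleFundamentalGroup (specOver i Ω).hom)
    (y z : artinSchreierFiber i p Ω f) :
    fiberCoord (σ • z) - fiberCoord z = fiberCoord (σ • y) - fiberCoord y := by
  obtain ⟨n, hn⟩ := exists_natCast_eq_of_pow_eq (fiberCoord_sub_pow y z)
  have hz : z = (fiberFunctor (specOver i Ω).hom).map
      (specCoverMap i (artinSchreierTranslation p f n)) y :=
    fiberCoord_injective (by rw [fiberCoord_map_translation, hn]; ring)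
  rw [hz, PreGaloisCategory.mulAction_naturality, fiberCoord_map_translation,
    fiberCoord_map_translation]
  ring

/-- The character of the fundamental group on the covering `y ^ p - y = f`: the amount by which an
element translates the fibre, an element of the prime field of `Ω`. It is computed at the point `y`
of the fibre, although it does not depend on it. -/
noncomputable def artinSchreierCharacter (y : artinSchreierFiber i p Ω f) :
    EtaleFundamentalGroup (specOver i Ω).hom →* Multiplicative Ω :=
  MonoidHom.mk' (fun σ ↦ .ofAdd (fiberCoord (σ • y) - fiberCoord y)) fun σ τ ↦ by
    rw [← ofAdd_add, mul_smul, ← fiberCoord_smul_sub σ y (τ • y)]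
    congr 1
    ring

lemma isClosed_artinSchreierCharacter_eq {g : A} (y : artinSchreierFiber i p Ω f)
    (z : artinSchreierFiber i p Ω g) :
    IsClosed {σ | artinSchreierCharacter y σ = artinSchreierCharacter z σ} := by
  have h (g : A) (y : artinSchreierFiber i p Ω g) :
      Continuous fun σ : EtaleFundamentalGroup (specOver i Ω).hom ↦ σ • y := by fun_prop
  exact (isClosed_discrete {w : artinSchreierFiber i p Ω f × artinSchreierFiber i p Ω g |
    Multiplicative.ofAdd (fiberCoord w.1 - fiberCoord y) =
      Multiplicative.ofAdd (fiberCoord w.2 - fiberCoord z)}).preimage ((h f y).prodMk (h g z))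

end Character

/-! ### The affine line -/

/-- The fundamental group of a scheme isomorphic to `Spec k[X]` is not topologically finitely
generated at a geometric point given by a `k[X]`-algebra structure on `Ω`. -/
theorem not_isTopologicallyFG_of_iso {X : Scheme.{u}} {k : Type u} [Field k] [IsAlgClosed k] (p : ℕ)
    [Fact p.Prime] [CharP k p] (i : Spec (.of k[X]) ≅ X) (Ω : Type u) [Field Ω] [IsSepClosed Ω]
    [Algebra k[X] Ω] : ¬ IsTopologicallyFG (EtaleFundamentalGroup (specOver i Ω).hom) := by
  let K := FractionRing k[X]
  let L := SeparableClosure K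
  let B := integralClosure k[X] L
  have : CharP Ω p := (CharP.charP_iff_prime_eq_zero Fact.out).2 <| by
    rw [← map_natCast (algebraMap k[X] Ω), CharP.cast_eq_zero, map_zero]
  have : CharP L p := (CharP.charP_iff_prime_eq_zero Fact.out).2 <| by
    rw [← map_natCast (algebraMap k[X] L), CharP.cast_eq_zero, map_zero]
  have : CharP B p := (CharP.charP_iff_prime_eq_zero Fact.out).2 <| by
    rw [← map_natCast (algebraMap k[X] B), CharP.cast_eq_zero, map_zero]
  obtain ⟨ε⟩ : Nonempty (B →ₐ[k[X]] Ω) := exists_algHom_integralClosure k K L Ω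
  have hbij := bijective_specOverMap_comp i ε fun R ↦ bijective_comp_of_integralClosure R ε
  -- The difference of any two of these polynomials has degree prime to `p`.
  let f (n : ℕ) : k[X] := Polynomial.X ^ (p * n + 1)
  choose a ha using fun n ↦ exists_pow_sub_self_eq_algebraMap (p := p) (L := L) (f n)
  let q (n : ℕ) : (artinSchreierPair p (f n)).Ring →ₐ[k[X]] B :=
    (artinSchreierPair p (f n)).lift (a n) (artinSchreierPair_hasMap_iff.2 (ha n))
  let y (n : ℕ) : artinSchreierFiber i p Ω (f n) := fiberEquiv i _ Ω (ε.comp (q n))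
  refine not_isTopologicallyFG_of_monoidHom (ι := ℕ)
    (V := Multiplicative.toAdd ⁻¹' {c : Ω | c ^ p = c}) ?_
    (fun n ↦ artinSchreierCharacter (y n)) ?_ ?_ fun m n ↦ isClosed_artinSchreierCharacter_eq _ _
  · have : Fintype (⊥ : Subfield Ω) := Subfield.fintypeBot Ω p
    have h : {c : Ω | c ^ p = c} = ((⊥ : Subfield Ω) : Set Ω) := by
      ext c
      exact (Subfield.mem_bot_iff_pow_eq_self Ω p).symm
    rw [h]
    exact (Set.toFinite _).preimage Multiplicative.toAdd.injective.injOn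
  · exact fun n σ ↦ fiberCoord_sub_pow (y n) (σ • y n)
  · intro m n hmn
    by_contra hne
    obtain ⟨τ, hτ⟩ : ∃ τ : B ≃ₐ[k[X]] B, τ (a m) - a m ≠ τ (a n) - a n :=
      exists_algEquiv_sub_ne (K := K) (pow_sub_self_ne_X_pow_sub_X_pow hne) (ha m) (ha n)
    let σ : EtaleFundamentalGroup (specOver i Ω).hom :=
      autOfBijective (specOverMap i ε) hbij (specOverIso i τ).symm
    have hσ (n : ℕ) : fiberCoord (σ • y n) - fiberCoord (y n) = ε (τ (a n) - a n) := by
      have h : σ • y n = fiberEquiv i _ Ω (ε.comp (τ.toAlgHom.comp (q n))) := by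
        have hy : y n = specOverMap i ε ≫ specOverMap i (q n) := specOverMap_comp i (q n) ε
        rw [hy]
        refine (autOfBijective_smul (specOverMap i ε) hbij (specOverIso i τ).symm
          (artinSchreierCover i p (f n)) (specOverMap i (q n))).trans ?_
        change _ = specOverMap i _
        rw [specOverMap_comp, specOverMap_comp]
        rfl
      rw [h, fiberCoord_fiberEquiv, fiberCoord_fiberEquiv]
      simp [q, StandardEtalePair.lift_X]
    have hε : ε (τ (a m) - a m) = ε (τ (a n) - a n) := by
      rw [← hσ, ← hσ]
      exact congrArg Multiplicative.toAdd (DFunLike.congr_fun hmn σ)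
    have hpow (n : ℕ) : (τ (a n) - a n) ^ p = τ (a n) - a n := by
      have := congrArg τ (ha n)
      rw [map_sub, map_pow, AlgEquiv.commutes] at this
      rw [sub_pow_char]
      linear_combination this - ha n
    -- An element of the prime field killed by `ε` is zero; as `B` is only a domain, this is seen
    -- from the fact that its power with exponent `p - 1` would be `1`.
    have hd : (τ (a m) - a m - (τ (a n) - a n)) ^ (p - 1) = 1 := by
      refine mul_right_cancel₀ (sub_ne_zero.2 hτ) ?_
      rw [← pow_succ, Nat.sub_add_cancel (Fact.out : p.Prime).one_le, sub_pow_char, hpow, hpow,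
        one_mul]
    have := congrArg ε hd
    rw [map_pow, map_sub, hε, sub_self, map_one,
      zero_pow (Nat.sub_ne_zero_of_lt (Fact.out : p.Prime).one_lt)] at this
    exact zero_ne_one this

end EtalePi1

theorem proposition2 {k : Type u} [Field k] [IsAlgClosed k] (p : ℕ) [Fact p.Prime] [CharP k p]
    {Ω : Type u} [Field Ω] [IsSepClosed Ω]
    (x : Spec (.of Ω) ⟶ AffineSpace PUnit.{u + 1} (Spec (.of k))) :
    ¬ EtalePi1.IsTopologicallyFG (EtalePi1.EtaleFundamentalGroup x) := by
  let i : Spec (.of (Polynomial k)) ≅ AffineSpace PUnit.{u + 1} (Spec (.of k)) :=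
    Scheme.Spec.mapIso (MvPolynomial.uniqueAlgEquiv k PUnit).toRingEquiv.toCommRingCatIso.op ≪≫
      (AffineSpace.SpecIso PUnit.{u + 1} (.of k)).symm
  -- The geometric point `x` makes `Ω` an algebra over the coordinate ring.
  obtain ⟨φ, hφ⟩ := Spec.map_surjective (x ≫ i.inv)
  let _ : Algebra (Polynomial k) Ω := φ.hom.toAlgebra
  obtain rfl : x = (EtalePi1.specOver i Ω).hom := by
    change x = Spec.map φ ≫ i.hom
    simp [hφ]
  exact EtalePi1.not_isTopologicallyFG_of_iso p i Ω
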